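/- Let $\mathcal M\hookrightarrow\mathbb R^{D}$ be a smooth embedded submanifold (without boundary, of dimension $m$) with the induced Riemannian metric $g$, let $q\in\mathcal M$, and let $n\in\mathbb R^{D}$ be perpendicular to $T_q\mathcal M$. **Notation.** Let $\Delta=\operatorname{div}\operatorname{grad}$ be the Laplace–Beltrami operator of $g$, and put $$\mathrm{Lbnz}_\Delta[f_1,f_2]=\Delta[f_1f_2]-f_1\Delta[f_2]-f_2\Delta[f_1],\qquad \mathcal A[f_1,f_2,f_3]=\mathrm{Lbnz}_\Delta\big[f_1,\mathrm{Lbnz}_\Delta[f_2,f_3]\big].$$ Let $\phi_d:\mathcal M\to\mathbb R$ be the $d$-th ambient coordinate, and let $\eta(p)=\langle n,p-q\rangle$ be the height function. For $1\le d_1,d_2\le D$ put $$R_{d_1d_2}=\tfrac18\Big(\mathcal A[\phi_{d_1},\eta,\phi_{d_2}](q)+\mathcal A[\phi_{d_2},\eta,\phi_{d_1}](q)-\mathcal A[\eta,\phi_{d_1},\phi_{d_2}](q)\Big).$$ The shape operator is $s(n,u_1,u_2)=-\langle\nabla_{u_1}N|_q,u_2\rangle$ for $u_1,u_2\in T_q\mathcal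 M$, where $\nabla$ is the flat connection of $\mathbb R^D$ and $N$ is a smooth section of the normal bundle over a neighbourhood of $q$ with $N(q)=n$. For $c\ge 0$, a tangent vector $v\in T_q\mathcal M$ is called *derived by a $d$-th coordinate curve of speed $c$* if $\|v\|=c$, $v=\dot\gamma(0)$ for a continuous curve $\gamma:\mathbb R\to\mathcal M$ with $\gamma(0)=q$ that is differentiable at $0$ as a curve in $\mathbb R^D$, and $\gamma$ maximizes $\frac{d}{ds}\phi_d(\gamma(s))|_{s=0}$ among all such curves with $\|\dot\gamma(0)\|=c$. **Proposition.** Let $1\le d_1,d_2\le D$, and let $v_{d_1},v_{d_2}\in T_q\mathcal M$ be derived by a $d_1$-th and a $d_2$-th coordinate curve of speeds $c_{d_1}$ and $c_{d_2}$, respectively. Then there is a smooth section $N$ of the normal bundle of $\mathcal M$ with $N(q)=n$, and for every choice of the local section $N$ in the definition of $s$ the following hold. 1. If $c_{d_1}=\|\operatorname{grad}\phi_{d_1}(q)\|$ and $c_{d_2}=\|\operatorname{grad}\phi_{d_2}(q)\|$, then $$s(n,v_{d_1},v_{d_2})=R_{d_1d_2}.$$ 2. For arbitrary speeds, $$\|\operatorname{grad}\phi_{d_1}(q)\|\,\|\operatorname{grad}\phi_{d_2}(q)\|\;s(n,v_{d_1},v_{d_2})=c_{d_1}c_{d_2}\,R_{d_1d_2}.$$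 -/

import Mathlib

open scoped Manifold ContDiff InnerProductSpace

noncomputable section

namespace CurveShape

variable {m D : ℕ} {M : Type*} [TopologicalSpace M] [ChartedSpace (EuclideanSpace ℝ (Fin m)) M]

/-! ### First-order extrinsic geometry of a map `ι : M → ℝ^D`

The Riemannian metric on `M` is always the one induced by `ι`. -/

/-- The derivative `dF_p u` of a map `F : M → ℝ^D` along `u`, as a vector of `ℝ^D`. For `F = ι` it
identifies tangent vectors of `M` with vectors of `ℝ^D`; for an `ℝ^D`-valued vector field `F` along
`M` it is the derivative by the flat connection of `ℝ^D`. -/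
def push (F : M → EuclideanSpace ℝ (Fin D)) (p : M) (u : TangentSpace (𝓡 m) p) :
    EuclideanSpace ℝ (Fin D) :=
  mfderiv (𝓡 m) 𝓘(ℝ, EuclideanSpace ℝ (Fin D)) F p u

/-- The induced metric `g_p(u, v) = ⟨dι_p u, dι_p v⟩`. -/
def metric (ι : M → EuclideanSpace ℝ (Fin D)) (p : M) (u v : TangentSpace (𝓡 m) p) : ℝ :=
  inner ℝ (push ι p u) (push ι p v)

/-- The length `g_p(u, u)^{1/2}` of a tangent vector. -/
def metricNorm (ι : M → EuclideanSpace ℝ (Fin D)) (p : M) (u : TangentSpace (𝓡 m) p) : ℝ :=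
  Real.sqrt (metric ι p u u)

/-- `n` is a normal vector at `p`: it is perpendicular to the tangent space at `p`. -/
def IsNormalVector (ι : M → EuclideanSpace ℝ (Fin D)) (p : M) (n : EuclideanSpace ℝ (Fin D)) :
    Prop :=
  ∀ u : TangentSpace (𝓡 m) p, inner ℝ n (push ι p u) = 0

/-- `N` is a smooth section of the normal bundle over `U`. -/
structure IsNormalSectionOn (ι : M → EuclideanSpace ℝ (Fin D)) (U : Set M)
    (N : M → EuclideanSpace ℝ (Fin D)) : Prop where
  smooth : ContMDiffOn (𝓡 m) 𝓘(ℝ, EuclideanSpace ℝ (Fin D)) ∞ N U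
  normal : ∀ p ∈ U, IsNormalVector (m := m) ι p (N p)

/-- `-⟨∇_{u₁} N, u₂⟩` at `p`, where `∇` is the flat connection of `ℝ^D`: the value of the shape
operator on `(N p, u₁, u₂)`, computed with the normal section `N`. -/
def shapeOperator (ι N : M → EuclideanSpace ℝ (Fin D)) (p : M) (u₁ u₂ : TangentSpace (𝓡 m) p) :
    ℝ :=
  - inner ℝ (push N p u₁) (push ι p u₂)

/-- The `d`-th ambient coordinate, as a function on `M`. -/
def coordFun (ι : M → EuclideanSpace ℝ (Fin D)) (d : Fin D) : M → ℝ := fun p => ι p d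

/-- The height function `η(p) = ⟨n, p - q⟩`. -/
def height (ι : M → EuclideanSpace ℝ (Fin D)) (q : M) (n : EuclideanSpace ℝ (Fin D)) : M → ℝ :=
  fun p => inner ℝ n (ι p - ι q)

/-! ### Curve-derived tangent vectors -/

/-- The continuous curve `γ` in `M` passes through `q` at time `0` and has velocity `v` there; the
time derivative is taken in the ambient space. -/
structure DerivesTangent (ι : M → EuclideanSpace ℝ (Fin D)) (q : M) (γ : ℝ → M)
    (v : TangentSpace (𝓡 m) q) : Prop where
  continuous : Continuous γ
  start : γ 0 = q
  velocity : HasDerivAt (fun s => ι (γ s)) (push ι q v) 0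

/-- `v` is a tangent vector derived by a coordinate curve for the `d`-th ambient coordinate with
speed `c`: among all curves through `q` of speed `c` at time `0`, the curve deriving `v` maximizes
the rate of change of the `d`-th coordinate. -/
def IsCoordDerived (ι : M → EuclideanSpace ℝ (Fin D)) (q : M) (d : Fin D) (c : ℝ)
    (v : TangentSpace (𝓡 m) q) : Prop :=
  ∃ γ : ℝ → M, DerivesTangent ι q γ v ∧ metricNorm ι q v = c ∧
    ∀ (γ' : ℝ → M) (v' : TangentSpace (𝓡 m) q), DerivesTangent ι q γ' v' →
      metricNorm ι q v' = c →
        deriv (fun s => coordFun ι d (γ' s)) 0 ≤ deriv (fun s => coordFun ι d (γ s)) 0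

/-! ### Gradient, divergence and the Laplace–Beltrami operator of the induced metric

Everything is written in the preferred chart at a point `p₀`; `x` denotes chart coordinates. -/

/-- The partial derivative `∂_i F` at `x`. -/
def pd {V : Type*} [NormedAddCommGroup V] [NormedSpace ℝ V] (i : Fin m)
    (F : EuclideanSpace ℝ (Fin m) → V) (x : EuclideanSpace ℝ (Fin m)) : V :=
  fderiv ℝ F x (EuclideanSpace.single i 1)

/-- The coordinate expression of a function near `p₀`. -/
def inChart {V : Type*} (p₀ : M) (f : M → V) : EuclideanSpace ℝ (Fin m) → V :=
  fun x => f ((extChartAt (𝓡 m) p₀).symm x)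

/-- The coefficients `g_{ij} = ⟨∂_i ι, ∂_j ι⟩` of the induced metric. -/
def metricCoeff (ι : M → EuclideanSpace ℝ (Fin D)) (p₀ : M) (x : EuclideanSpace ℝ (Fin m)) :
    Matrix (Fin m) (Fin m) ℝ :=
  Matrix.of fun i j => inner ℝ (pd i (inChart p₀ ι) x) (pd j (inChart p₀ ι) x)

/-- The coefficients `g^{ij}` of the inverse metric. -/
def metricInvCoeff (ι : M → EuclideanSpace ℝ (Fin D)) (p₀ : M) (x : EuclideanSpace ℝ (Fin m)) :
    Matrix (Fin m) (Fin m) ℝ :=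
  (metricCoeff ι p₀ x)⁻¹

/-- The Christoffel symbols of the Levi-Civita connection, `∇_{∂_j} ∂_k = ∑ d, Γ_{jk}^d ∂_d`:
`Γ_{jk}^d = 1/2 ∑ l, g^{dl} (∂_j g_{kl} + ∂_k g_{jl} - ∂_l g_{jk})`. -/
def christoffel (ι : M → EuclideanSpace ℝ (Fin D)) (p₀ : M) (j k d : Fin m)
    (x : EuclideanSpace ℝ (Fin m)) : ℝ :=
  1 / 2 * ∑ l, metricInvCoeff ι p₀ x d l *
    (pd j (fun y => metricCoeff ι p₀ y k l) x + pd k (fun y => metricCoeff ι p₀ y j l) x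
      - pd l (fun y => metricCoeff ι p₀ y j k) x)

/-- The components `b_d = ∑ d', g^{dd'} ∂_{d'} f` of the gradient field of `f`. -/
def gradCoeff (ι : M → EuclideanSpace ℝ (Fin D)) (p₀ : M) (f : M → ℝ) (d : Fin m)
    (x : EuclideanSpace ℝ (Fin m)) : ℝ :=
  ∑ d', metricInvCoeff ι p₀ x d d' * pd d' (inChart p₀ f) x

/-- The divergence (the trace of the covariant derivative) of the vector field with components
`u_d`: `∑ d, ∂_d u_d + ∑ j d, Γ_{jd}^j u_d`. -/
def divergence (ι : M → EuclideanSpace ℝ (Fin D)) (p₀ : M)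
    (u : Fin m → EuclideanSpace ℝ (Fin m) → ℝ) (x : EuclideanSpace ℝ (Fin m)) : ℝ :=
  ∑ d, pd d (u d) x + ∑ j, ∑ d, christoffel ι p₀ j d j x * u d x

/-- The Laplace–Beltrami operator `Δ f = div (grad f)`. -/
def laplaceBeltrami (ι : M → EuclideanSpace ℝ (Fin D)) (f : M → ℝ) : M → ℝ :=
  fun p => divergence (m := m) ι p (gradCoeff ι p f) (extChartAt (𝓡 m) p p)

/-- The gradient at `p`; vectors of `TangentSpace (𝓡 m) p` are given by their components in the
preferred chart at `p`. -/
def gradient (ι : M → EuclideanSpace ℝ (Fin D)) (f : M → ℝ) (p : M) : TangentSpace (𝓡 m) p :=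
  (WithLp.toLp 2 fun d => gradCoeff ι p f d (extChartAt (𝓡 m) p p) : EuclideanSpace ℝ (Fin m))

/-- The Leibniz defect `L[f₁ f₂] - f₁ L[f₂] - f₂ L[f₁]` of an operator `L` on functions. -/
def Lbnz (L : (M → ℝ) → M → ℝ) (f₁ f₂ : M → ℝ) : M → ℝ :=
  L (f₁ * f₂) - f₁ * L f₂ - f₂ * L f₁

/-- The nested Leibniz defect `Lbnz_Δ[f₁, Lbnz_Δ[f₂, f₃]]` of the Laplace–Beltrami operator. -/
def nestedLbnz (ι : M → EuclideanSpace ℝ (Fin D)) (f₁ f₂ f₃ : M → ℝ) : M → ℝ :=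
  Lbnz (laplaceBeltrami (m := m) ι) f₁ (Lbnz (laplaceBeltrami (m := m) ι) f₂ f₃)

/-- The combination `1/8 (A[φ_{d₁}, η, φ_{d₂}] + A[φ_{d₂}, η, φ_{d₁}] - A[η, φ_{d₁}, φ_{d₂}])(q)`,
where `A` is the nested Leibniz defect. -/
def shapeExpr (m : ℕ) {D : ℕ} {M : Type*} [TopologicalSpace M]
    [ChartedSpace (EuclideanSpace ℝ (Fin m)) M] (ι : M → EuclideanSpace ℝ (Fin D)) (q : M)
    (n : EuclideanSpace ℝ (Fin D)) (d₁ d₂ : Fin D) : ℝ :=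
  1 / 8 * (nestedLbnz (m := m) ι (coordFun ι d₁) (height ι q n) (coordFun ι d₂) q
    + nestedLbnz (m := m) ι (coordFun ι d₂) (height ι q n) (coordFun ι d₁) q
    - nestedLbnz (m := m) ι (height ι q n) (coordFun ι d₁) (coordFun ι d₂) q)

end CurveShape

end

/-! The Christoffel part of `Δ` is linear in the gradient, so the product rule gives `Lbnz_Δ[f, g] =
2⟨grad f, grad g⟩`. An affine function `⟨a, ·⟩ + c` on `M` has gradient `P a`, the tangential
projection of `a`. Hence `A[f, η, φ_d] = 4⟨D_{grad f}(P n), e_d⟩` (`nestedLbnz_affineFun`). Since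
`n` is normal at `q`, `n - P n` is a normal section through `n`, and the right side at `q` is `4
s(n, grad f, grad φ_d)` (`shapeOperator_gradient`). Differentiating `⟨N, dι v⟩ = 0` gives `s(n, u,
v) = ⟨n, D²ι(u, v)⟩`, so `s` is symmetric and independent of the section. The term `A[η, ·, ·](q)`
vanishes because `grad η(q) = P n = 0`. Thus `R = s(n, grad φ_{d₁}, grad φ_{d₂})`
(`shapeExpr_eq_shapeOperator`). A maximizing curve realizes equality in Cauchy–Schwarz, which gives
`‖grad φ_d‖ v = c grad φ_d` (`IsCoordDerived.norm_gradient_smul_eq`). Bilinearity of `s` does the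
rest. -/

noncomputable section

namespace CurveShape

open Filter Topology

/-! ### Gram matrices and orthogonal projection onto a range. -/

section LinearAlgebra

variable {m : ℕ} {V : Type*} [NormedAddCommGroup V] [InnerProductSpace ℝ V]

/-- The Gram matrix of the images of the standard basis vectors under a linear map. -/
def gramMatrix (B : EuclideanSpace ℝ (Fin m) →L[ℝ] V) : Matrix (Fin m) (Fin m) ℝ :=
  Matrix.of fun i j =>
    inner ℝ (B (EuclideanSpace.single i 1)) (B (EuclideanSpace.single j 1))

theorem map_eq_sum (B : EuclideanSpace ℝ (Fin m) →L[ℝ] V) (u : EuclideanSpace ℝ (Fin m)) :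
    B u = ∑ i, u i • B (EuclideanSpace.single i 1) := by
  conv_lhs => rw [← (EuclideanSpace.basisFun (Fin m) ℝ).sum_repr u]
  simp [map_sum]

theorem gramMatrix_isSymm (B : EuclideanSpace ℝ (Fin m) →L[ℝ] V) : (gramMatrix B).IsSymm := by
  ext i j
  simp [gramMatrix, real_inner_comm]

theorem inner_map_single (B : EuclideanSpace ℝ (Fin m) →L[ℝ] V) (u : EuclideanSpace ℝ (Fin m))
    (i : Fin m) :
    inner ℝ (B (EuclideanSpace.single i 1)) (B u) = (gramMatrix B).mulVec u.ofLp i := by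
  rw [map_eq_sum B u, inner_sum]
  simp [Matrix.mulVec, dotProduct, gramMatrix, inner_smul_right, mul_comm]

/-- A kernel vector `u` of the Gram matrix satisfies `‖B u‖² = uᵀ G u = 0`. -/
theorem isUnit_det_gramMatrix {B : EuclideanSpace ℝ (Fin m) →L[ℝ] V}
    (hB : Function.Injective B) : IsUnit (gramMatrix B).det := by
  rw [isUnit_iff_ne_zero]
  intro h
  obtain ⟨u, hu, h0⟩ := Matrix.exists_mulVec_eq_zero_iff.mpr h
  apply hu
  have h1 : inner ℝ (B (WithLp.toLp 2 u)) (B (WithLp.toLp 2 u)) = 0 := by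
    conv_lhs => arg 2; rw [map_eq_sum]
    rw [sum_inner]
    refine Finset.sum_eq_zero fun i _ => ?_
    rw [real_inner_smul_left, inner_map_single]
    simp [h0]
  have h2 : WithLp.toLp 2 u = 0 := hB (by rw [inner_self_eq_zero.mp h1, map_zero])
  simpa using h2

/-- The orthogonal projection onto the range of an injective linear map, in terms of the inverse
Gram matrix. -/
theorem starProjection_range_eq [FiniteDimensional ℝ V] {B : EuclideanSpace ℝ (Fin m) →L[ℝ] V}
    (hB : Function.Injective B) (a : V) :
    (LinearMap.range B.toLinearMap).starProjection a =
      B (WithLp.toLp 2 fun i => ∑ j, (gramMatrix B)⁻¹ i j *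
        inner ℝ (B (EuclideanSpace.single j 1)) a) := by
  symm
  set u : EuclideanSpace ℝ (Fin m) := WithLp.toLp 2 fun i => ∑ j, (gramMatrix B)⁻¹ i j *
        inner ℝ (B (EuclideanSpace.single j 1)) a with hu
  have hu' : u.ofLp = (gramMatrix B)⁻¹.mulVec
      fun j => inner ℝ (B (EuclideanSpace.single j 1)) a := rfl
  -- The projection is characterized by lying in the range with residual orthogonal to it;
  -- orthogonality reduces to `G G⁻¹ = 1`.
  refine (Submodule.eq_starProjection_of_mem_of_inner_eq_zero (LinearMap.mem_range_self _ u) ?_).symm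
  rintro _ ⟨v, rfl⟩
  rw [real_inner_comm]
  change inner ℝ (B v) _ = _
  rw [map_eq_sum B v, sum_inner]
  refine Finset.sum_eq_zero fun i _ => ?_
  rw [real_inner_smul_left, inner_sub_right, ContinuousLinearMap.coe_coe, inner_map_single,
    hu', Matrix.mulVec_mulVec,
    Matrix.mul_nonsing_inv _ (isUnit_det_gramMatrix hB)]
  simp

end LinearAlgebra

/-! ### Smooth dependence of the inverse matrix. -/

section MatrixInverse

variable {X : Type*} [NormedAddCommGroup X] [NormedSpace ℝ X] {ι : Type*} [Fintype ι]
  [DecidableEq ι] {k : WithTop ℕ∞} {A : X → Matrix ι ι ℝ} {x : X}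

theorem contDiffAt_det (hA : ∀ i j, ContDiffAt ℝ k (fun y => A y i j) x) :
    ContDiffAt ℝ k (fun y => (A y).det) x := by
  simp only [Matrix.det_apply]
  exact ContDiffAt.sum fun σ _ => (contDiffAt_prod fun i _ => hA _ _).const_smul _

/-- Cramer's rule: each entry is `det⁻¹` times the determinant of the matrix with one row replaced
by a constant one. -/
theorem contDiffAt_matrix_inv (hA : ∀ i j, ContDiffAt ℝ k (fun y => A y i j) x)
    (hx : IsUnit (A x).det) (i j : ι) : ContDiffAt ℝ k (fun y => (A y)⁻¹ i j) x := by
  simp only [Matrix.inv_def, Matrix.smul_apply, Ring.inverse_eq_inv', smul_eq_mul,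
    Matrix.adjugate_apply]
  refine ((contDiffAt_det hA).inv hx.ne_zero).mul (contDiffAt_det fun a b => ?_)
  by_cases h : a = j
  · subst h
    simpa using contDiffAt_const
  · simpa [Matrix.updateRow_ne h] using hA a b

end MatrixInverse

variable {m D : ℕ} {M : Type*} [TopologicalSpace M]
  [ChartedSpace (EuclideanSpace ℝ (Fin m)) M]

/-! ### Functions and maps read in a chart -/

/-- The components of a tangent vector in the preferred chart. -/
def chartVec {p : M} (u : TangentSpace (𝓡 m) p) : EuclideanSpace ℝ (Fin m) := u

section Charts

variable {V : Type*} [NormedAddCommGroup V] [NormedSpace ℝ V]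

theorem extChartAt_target_mem_nhds_of_mem {p : M} {x : EuclideanSpace ℝ (Fin m)}
    (hx : x ∈ (extChartAt (𝓡 m) p).target) : (extChartAt (𝓡 m) p).target ∈ 𝓝 x :=
  (isOpen_extChartAt_target p).mem_nhds hx

theorem contDiffAt_inChart [IsManifold (𝓡 m) ∞ M] {f : M → V} {p : M}
    {x : EuclideanSpace ℝ (Fin m)} (hx : x ∈ (extChartAt (𝓡 m) p).target)
    (hf : ContMDiffAt (𝓡 m) 𝓘(ℝ, V) ∞ f ((extChartAt (𝓡 m) p).symm x)) :
    ContDiffAt ℝ ∞ (inChart p f) x := by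
  rw [← contMDiffAt_iff_contDiffAt]
  exact hf.comp x ((contMDiffOn_extChartAt_symm p).contMDiffAt
    (extChartAt_target_mem_nhds_of_mem hx))

theorem contMDiffAt_of_inChart [IsManifold (𝓡 m) ∞ M] {f : M → V} {p : M}
    (hf : ContDiffAt ℝ ∞ (inChart p f) (extChartAt (𝓡 m) p p)) :
    ContMDiffAt (𝓡 m) 𝓘(ℝ, V) ∞ f p := by
  rw [contMDiffAt_iff_source]
  exact (contMDiffAt_iff_contDiffAt.mpr hf).contMDiffWithinAt

theorem mfderiv_eq_fderiv_inChart {f : M → V} {p : M}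
    (hf : MDifferentiableAt (𝓡 m) 𝓘(ℝ, V) f p) (u : TangentSpace (𝓡 m) p) :
    mfderiv (𝓡 m) 𝓘(ℝ, V) f p u = fderiv ℝ (inChart p f) (extChartAt (𝓡 m) p p) (chartVec u) := by
  change _ = fderiv ℝ (inChart p f) (extChartAt (𝓡 m) p p) u
  rw [hf.mfderiv]
  simp only [modelWithCornersSelf_coe, Set.range_id, fderivWithin_univ]
  rfl

/-- `mfderiv` at a nearby point refers to that point's own preferred chart; the invertible `A`
converts it to the fixed chart at `p`, where it can be differentiated again. -/
theorem fderiv_inChart_eq_comp [IsManifold (𝓡 m) ∞ M] {f : M → V} {p : M}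
    {x : EuclideanSpace ℝ (Fin m)} (hx : x ∈ (extChartAt (𝓡 m) p).target)
    (hf : MDifferentiableAt (𝓡 m) 𝓘(ℝ, V) f ((extChartAt (𝓡 m) p).symm x)) :
    ∃ A : EuclideanSpace ℝ (Fin m) ≃L[ℝ] TangentSpace (𝓡 m) ((extChartAt (𝓡 m) p).symm x),
      ∀ u : EuclideanSpace ℝ (Fin m), fderiv ℝ (inChart p f) x u =
        mfderiv (𝓡 m) 𝓘(ℝ, V) f ((extChartAt (𝓡 m) p).symm x) (A u) := by
  have : IsManifold (𝓡 m) 1 M := IsManifold.of_le (n := ∞) (by simp)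
  obtain ⟨A, hA⟩ := isInvertible_mfderivWithin_extChartAt_symm hx
  refine ⟨A, fun u => ?_⟩
  have hs := mdifferentiableWithinAt_extChartAt_symm hx
  simp only [modelWithCornersSelf_coe, Set.range_id, mdifferentiableWithinAt_univ,
    mfderivWithin_univ] at hs hA
  rw [← mfderiv_eq_fderiv]
  change mfderiv 𝓘(ℝ, EuclideanSpace ℝ (Fin m)) 𝓘(ℝ, V) (f ∘ (extChartAt (𝓡 m) p).symm) x u = _
  rw [mfderiv_comp x hf hs, ← hA]
  rfl

end Charts

/-- In immersion charts `ι` reads `u ↦ (u, 0)`, so projecting to the first factor and returning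
through the chart is a differentiable local left inverse; the chain rule finishes. -/
theorem mfderiv_injective_of_isSmoothEmbedding [IsManifold (𝓡 m) ∞ M]
    {ι : M → EuclideanSpace ℝ (Fin D)}
    (hι : Manifold.IsSmoothEmbedding (𝓡 m) 𝓘(ℝ, EuclideanSpace ℝ (Fin D)) ∞ ι) (p : M) :
    Function.Injective (mfderiv (𝓡 m) 𝓘(ℝ, EuclideanSpace ℝ (Fin D)) ι p) := by
  have h := hι.isImmersion.isImmersionAt p
  set e := h.domChart.extend (𝓡 m)
  set e' := h.codChart.extend 𝓘(ℝ, EuclideanSpace ℝ (Fin D))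
  have hps : p ∈ e.source := by simpa [e] using h.mem_domChart_source
  set r : EuclideanSpace ℝ (Fin D) → EuclideanSpace ℝ (Fin m) :=
    fun y => (h.equiv.symm (e' y)).1
  have hr : MDifferentiableAt 𝓘(ℝ, EuclideanSpace ℝ (Fin D))
      𝓘(ℝ, EuclideanSpace ℝ (Fin m)) r (ι p) := by
    have h1 : ContMDiffAt 𝓘(ℝ, EuclideanSpace ℝ (Fin D)) 𝓘(ℝ, EuclideanSpace ℝ (Fin D)) ∞ e'
        (ι p) := h.codChart.contMDiffAt_extend h.codChart_mem_maximalAtlas h.mem_codChart_source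
    have h2 := (h1.contDiffAt.differentiableAt (by simp))
    refine DifferentiableAt.mdifferentiableAt ?_
    exact differentiableAt_fst.comp _ (h.equiv.symm.differentiableAt.comp _ h2)
  have hre : ∀ y ∈ e.source, r (ι y) = e y := by
    intro y hy
    have h1 := h.writtenInCharts (e.map_source hy)
    simp only [Function.comp_apply] at h1
    rw [show (h.domChart.extend (𝓡 m)).symm (e y) = y from e.left_inv hy] at h1
    change (h.equiv.symm (e' (ι y))).1 = _
    rw [show e' (ι y) = _ from h1]
    simp
  have hopen : IsOpen e.source := by
    simpa [e] using h.domChart.open_source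
  have hes : MDifferentiableAt 𝓘(ℝ, EuclideanSpace ℝ (Fin m)) (𝓡 m) e.symm (r (ι p)) := by
    have h1 := contMDiffOn_extend_symm h.domChart_mem_maximalAtlas
    have h2 : (𝓡 m) '' h.domChart.target ∈ 𝓝 (r (ι p)) := by
      rw [hre p hps]
      simp only [modelWithCornersSelf_coe, Set.image_id]
      refine h.domChart.open_target.mem_nhds ?_
      simpa [e] using h.domChart.map_source h.mem_domChart_source
    exact (h1.contMDiffAt h2).mdifferentiableAt (by simp)
  have hιd : MDifferentiableAt (𝓡 m) 𝓘(ℝ, EuclideanSpace ℝ (Fin D)) ι p :=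
    hι.contMDiff.contMDiffAt.mdifferentiableAt (by simp)
  have hid : (e.symm ∘ r) ∘ ι =ᶠ[𝓝 p] id := by
    filter_upwards [hopen.mem_nhds hps] with y hy
    simp only [Function.comp_apply, hre y hy, e.left_inv hy, id]
  have h3 := hid.mfderiv_eq (I := 𝓡 m) (I' := 𝓡 m)
  rw [mfderiv_comp p (hes.comp _ hr) hιd, mfderiv_id] at h3
  intro u v huv
  have h4 := fun w => DFunLike.congr_fun h3 w
  simp only [ContinuousLinearMap.comp_apply] at h4
  have h5 := h4 u
  rw [huv, h4 v] at h5
  exact h5.symm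

/-- The tangent space of `ι(M)` at `ι p`, as a subspace of `ℝ^D`. -/
def tangentRange (ι : M → EuclideanSpace ℝ (Fin D)) (p : M) :
    Submodule ℝ (EuclideanSpace ℝ (Fin D)) :=
  LinearMap.range (mfderiv (𝓡 m) 𝓘(ℝ, EuclideanSpace ℝ (Fin D)) ι p).toLinearMap

/-- The orthogonal projection of `a` to the tangent space at `p`. -/
def tangentProj (m : ℕ) {M : Type*} [TopologicalSpace M]
    [ChartedSpace (EuclideanSpace ℝ (Fin m)) M] (ι : M → EuclideanSpace ℝ (Fin D))
    (a : EuclideanSpace ℝ (Fin D)) (p : M) : EuclideanSpace ℝ (Fin D) :=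
  (tangentRange (m := m) ι p).starProjection a

theorem contDiffAt_inChart_embedding [IsManifold (𝓡 m) ∞ M] {ι : M → EuclideanSpace ℝ (Fin D)}
    (hι : Manifold.IsSmoothEmbedding (𝓡 m) 𝓘(ℝ, EuclideanSpace ℝ (Fin D)) ∞ ι) {p : M}
    {x : EuclideanSpace ℝ (Fin m)} (hx : x ∈ (extChartAt (𝓡 m) p).target) :
    ContDiffAt ℝ ∞ (inChart p ι) x :=
  contDiffAt_inChart hx hι.contMDiff.contMDiffAt

/-! ### The induced metric in a chart -/

theorem metricCoeff_eq_gramMatrix (ι : M → EuclideanSpace ℝ (Fin D)) (p : M)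
    (x : EuclideanSpace ℝ (Fin m)) :
    metricCoeff ι p x = gramMatrix (fderiv ℝ (inChart p ι) x) := rfl

theorem fderiv_inChart_injective [IsManifold (𝓡 m) ∞ M] {ι : M → EuclideanSpace ℝ (Fin D)}
    (hι : Manifold.IsSmoothEmbedding (𝓡 m) 𝓘(ℝ, EuclideanSpace ℝ (Fin D)) ∞ ι) {p : M}
    {x : EuclideanSpace ℝ (Fin m)} (hx : x ∈ (extChartAt (𝓡 m) p).target) :
    Function.Injective (fderiv ℝ (inChart p ι) x) := by
  obtain ⟨A, hA⟩ := fderiv_inChart_eq_comp (f := ι) hx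
    (hι.contMDiff.contMDiffAt.mdifferentiableAt (by simp))
  intro u v huv
  rw [hA, hA] at huv
  exact A.injective (mfderiv_injective_of_isSmoothEmbedding hι _ huv)

theorem range_fderiv_inChart [IsManifold (𝓡 m) ∞ M] {ι : M → EuclideanSpace ℝ (Fin D)}
    (hι : Manifold.IsSmoothEmbedding (𝓡 m) 𝓘(ℝ, EuclideanSpace ℝ (Fin D)) ∞ ι) {p : M}
    {x : EuclideanSpace ℝ (Fin m)} (hx : x ∈ (extChartAt (𝓡 m) p).target) :
    tangentRange (m := m) ι ((extChartAt (𝓡 m) p).symm x) =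
      LinearMap.range (fderiv ℝ (inChart p ι) x).toLinearMap := by
  obtain ⟨A, hA⟩ := fderiv_inChart_eq_comp (f := ι) hx
    (hι.contMDiff.contMDiffAt.mdifferentiableAt (by simp))
  ext y
  constructor
  · rintro ⟨u, rfl⟩
    refine ⟨A.symm u, ?_⟩
    rw [ContinuousLinearMap.coe_coe, hA, A.apply_symm_apply]
    rfl
  · rintro ⟨u, rfl⟩
    exact ⟨A u, (hA u).symm⟩

theorem contDiffAt_pd {V : Type*} [NormedAddCommGroup V] [NormedSpace ℝ V]
    {F : EuclideanSpace ℝ (Fin m) → V} {x : EuclideanSpace ℝ (Fin m)} (hF : ContDiffAt ℝ ∞ F x)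
    (i : Fin m) : ContDiffAt ℝ ∞ (pd i F) x :=
  (hF.fderiv_right (m := ∞) (by simp)).clm_apply contDiffAt_const

theorem contDiffAt_metricInvCoeff [IsManifold (𝓡 m) ∞ M] {ι : M → EuclideanSpace ℝ (Fin D)}
    (hι : Manifold.IsSmoothEmbedding (𝓡 m) 𝓘(ℝ, EuclideanSpace ℝ (Fin D)) ∞ ι) {p : M}
    {x : EuclideanSpace ℝ (Fin m)} (hx : x ∈ (extChartAt (𝓡 m) p).target) (i j : Fin m) :
    ContDiffAt ℝ ∞ (fun y => metricInvCoeff ι p y i j) x := by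
  have hF := contDiffAt_inChart_embedding hι hx
  refine contDiffAt_matrix_inv (A := metricCoeff ι p) (fun a b => ?_) ?_ i j
  · exact (contDiffAt_pd hF a).inner ℝ (contDiffAt_pd hF b)
  · rw [metricCoeff_eq_gramMatrix]
    exact isUnit_det_gramMatrix (fderiv_inChart_injective hι hx)

theorem metricInvCoeff_symm (ι : M → EuclideanSpace ℝ (Fin D)) (p : M)
    (x : EuclideanSpace ℝ (Fin m)) (i j : Fin m) :
    metricInvCoeff ι p x i j = metricInvCoeff ι p x j i := by
  have h : (metricInvCoeff ι p x).IsSymm := by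
    rw [metricInvCoeff, metricCoeff_eq_gramMatrix]
    exact (gramMatrix_isSymm _).inv
  exact h.apply j i

theorem contDiffAt_gradCoeff [IsManifold (𝓡 m) ∞ M] {ι : M → EuclideanSpace ℝ (Fin D)}
    (hι : Manifold.IsSmoothEmbedding (𝓡 m) 𝓘(ℝ, EuclideanSpace ℝ (Fin D)) ∞ ι) {p : M}
    {x : EuclideanSpace ℝ (Fin m)} (hx : x ∈ (extChartAt (𝓡 m) p).target) {f : M → ℝ}
    (hf : ContDiffAt ℝ ∞ (inChart p f) x) (d : Fin m) :
    ContDiffAt ℝ ∞ (gradCoeff ι p f d) x :=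
  ContDiffAt.sum fun d' _ => (contDiffAt_metricInvCoeff hι hx d d').mul (contDiffAt_pd hf d')

/-- The tangential projection in terms of the inverse metric in a chart. -/
theorem tangentProj_eq_of_mem_target [IsManifold (𝓡 m) ∞ M] {ι : M → EuclideanSpace ℝ (Fin D)}
    (hι : Manifold.IsSmoothEmbedding (𝓡 m) 𝓘(ℝ, EuclideanSpace ℝ (Fin D)) ∞ ι) {p : M}
    {x : EuclideanSpace ℝ (Fin m)} (hx : x ∈ (extChartAt (𝓡 m) p).target)
    (a : EuclideanSpace ℝ (Fin D)) :
    tangentProj m ι a ((extChartAt (𝓡 m) p).symm x) =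
      fderiv ℝ (inChart p ι) x (WithLp.toLp 2 fun i => ∑ j, metricInvCoeff ι p x i j *
        inner ℝ (pd j (inChart p ι) x) a) := by
  have h := starProjection_range_eq (fderiv_inChart_injective hι hx) a
  simp only [← range_fderiv_inChart hι hx] at h
  exact h

theorem contMDiff_tangentProj [IsManifold (𝓡 m) ∞ M] {ι : M → EuclideanSpace ℝ (Fin D)}
    (hι : Manifold.IsSmoothEmbedding (𝓡 m) 𝓘(ℝ, EuclideanSpace ℝ (Fin D)) ∞ ι)
    (a : EuclideanSpace ℝ (Fin D)) :
    ContMDiff (𝓡 m) 𝓘(ℝ, EuclideanSpace ℝ (Fin D)) ∞ (tangentProj m ι a) := by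
  intro p
  refine contMDiffAt_of_inChart ?_
  have hx := mem_extChartAt_target (I := 𝓡 m) p
  have hF := contDiffAt_inChart_embedding hι hx
  have hev : inChart p (tangentProj m ι a) =ᶠ[𝓝 (extChartAt (𝓡 m) p p)] fun x =>
      ∑ i, (∑ j, metricInvCoeff ι p x i j * inner ℝ (pd j (inChart p ι) x) a) •
        pd i (inChart p ι) x := by
    filter_upwards [extChartAt_target_mem_nhds_of_mem hx] with y hy
    rw [inChart, tangentProj_eq_of_mem_target hι hy, map_eq_sum]
    rfl
  refine ContDiffAt.congr_of_eventuallyEq ?_ hev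
  refine ContDiffAt.sum fun i _ => ContDiffAt.fun_smul (ContDiffAt.sum fun j _ => ?_)
    (contDiffAt_pd hF i)
  exact (contDiffAt_metricInvCoeff hι hx i j).mul
    ((contDiffAt_pd hF j).inner ℝ contDiffAt_const)

/-! ### The Leibniz defect of the Laplace–Beltrami operator -/

theorem gradCoeff_mul {ι : M → EuclideanSpace ℝ (Fin D)} {p : M}
    {x : EuclideanSpace ℝ (Fin m)} {f g : M → ℝ} (hf : DifferentiableAt ℝ (inChart p f) x)
    (hg : DifferentiableAt ℝ (inChart p g) x) (d : Fin m) :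
    gradCoeff ι p (f * g) d x =
      inChart p f x * gradCoeff ι p g d x + inChart p g x * gradCoeff ι p f d x := by
  have h : ∀ i, pd i (inChart p (f * g)) x =
      inChart p f x * pd i (inChart p g) x + inChart p g x * pd i (inChart p f) x := by
    intro i
    change fderiv ℝ (inChart p f * inChart p g) x _ = _
    rw [fderiv_mul hf hg]
    simp [pd]
  simp only [gradCoeff, h, Finset.mul_sum, ← Finset.sum_add_distrib]
  exact Finset.sum_congr rfl fun i _ => by ring

theorem Lbnz_laplaceBeltrami_eq_sum [IsManifold (𝓡 m) ∞ M] {ι : M → EuclideanSpace ℝ (Fin D)}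
    (hι : Manifold.IsSmoothEmbedding (𝓡 m) 𝓘(ℝ, EuclideanSpace ℝ (Fin D)) ∞ ι) {p : M}
    {f g : M → ℝ} (hf : ContMDiffAt (𝓡 m) 𝓘(ℝ) ∞ f p) (hg : ContMDiffAt (𝓡 m) 𝓘(ℝ) ∞ g p) :
    Lbnz (laplaceBeltrami (m := m) ι) f g p =
      ∑ d, (pd d (inChart p f) (extChartAt (𝓡 m) p p) *
          gradCoeff ι p g d (extChartAt (𝓡 m) p p) +
        pd d (inChart p g) (extChartAt (𝓡 m) p p) *
          gradCoeff ι p f d (extChartAt (𝓡 m) p p)) := by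
  have hx := mem_extChartAt_target (I := 𝓡 m) p
  set x := extChartAt (𝓡 m) p p
  have hp : (extChartAt (𝓡 m) p).symm x = p := extChartAt_to_inv p
  have hF : ContDiffAt ℝ ∞ (inChart p f) x := contDiffAt_inChart hx (by rwa [hp])
  have hG : ContDiffAt ℝ ∞ (inChart p g) x := contDiffAt_inChart hx (by rwa [hp])
  have hFx : inChart p f x = f p := by rw [inChart, hp]
  have hGx : inChart p g x = g p := by rw [inChart, hp]
  -- The product rule is needed on a neighbourhood, since the divergence differentiates it once
  -- more.
  have hev : ∀ d, gradCoeff ι p (f * g) d =ᶠ[𝓝 x]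
      inChart p f * gradCoeff ι p g d + inChart p g * gradCoeff ι p f d := by
    intro d
    have h1 := (hF.of_le (m := 1) (by simp)).eventually (by simp)
    have h2 := (hG.of_le (m := 1) (by simp)).eventually (by simp)
    filter_upwards [h1, h2] with y h1 h2
    exact gradCoeff_mul (h1.differentiableAt (by simp)) (h2.differentiableAt (by simp)) d
  have hdF := hF.differentiableAt (by simp)
  have hdG := hG.differentiableAt (by simp)
  have hpd : ∀ d, pd d (gradCoeff ι p (f * g) d) x =
      f p * pd d (gradCoeff ι p g d) x + g p * pd d (gradCoeff ι p f d) x +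
      (pd d (inChart p f) x * gradCoeff ι p g d x +
        pd d (inChart p g) x * gradCoeff ι p f d x) := by
    intro d
    have hgf := (contDiffAt_gradCoeff hι hx hF d).differentiableAt (by simp)
    have hgg := (contDiffAt_gradCoeff hι hx hG d).differentiableAt (by simp)
    rw [pd, (hev d).fderiv_eq, fderiv_add (hdF.mul hgg) (hdG.mul hgf), fderiv_mul hdF hgg,
      fderiv_mul hdG hgf]
    simp only [add_apply, smul_apply, smul_eq_mul, hFx,
      hGx, pd]
    ring
  have hval : ∀ d, gradCoeff ι p (f * g) d x =
      f p * gradCoeff ι p g d x + g p * gradCoeff ι p f d x := by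
    intro d
    rw [gradCoeff_mul hdF hdG, hFx, hGx]
  change divergence ι p (gradCoeff ι p (f * g)) x - f p * divergence ι p (gradCoeff ι p g) x
    - g p * divergence ι p (gradCoeff ι p f) x = _
  have hchr : ∑ j, ∑ d, christoffel ι p j d j x * gradCoeff ι p (f * g) d x =
      f p * ∑ j, ∑ d, christoffel ι p j d j x * gradCoeff ι p g d x +
      g p * ∑ j, ∑ d, christoffel ι p j d j x * gradCoeff ι p f d x := by
    simp only [hval, Finset.mul_sum, ← Finset.sum_add_distrib]
    exact Finset.sum_congr rfl fun i _ => Finset.sum_congr rfl fun j _ => by ring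
  simp only [divergence]
  rw [hchr, Finset.sum_congr rfl fun d _ => hpd d]
  simp only [Finset.sum_add_distrib, ← Finset.mul_sum]
  ring

theorem sum_pd_mul_gradCoeff (ι : M → EuclideanSpace ℝ (Fin D)) (p : M) (f g : M → ℝ) :
    ∑ d, pd d (inChart p f) (extChartAt (𝓡 m) p p) * gradCoeff ι p g d (extChartAt (𝓡 m) p p) =
      fderiv ℝ (inChart p f) (extChartAt (𝓡 m) p p) (chartVec (gradient ι g p)) := by
  set u : EuclideanSpace ℝ (Fin m) := chartVec (gradient ι g p) with hu
  rw [← (EuclideanSpace.basisFun (Fin m) ℝ).sum_repr u]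
  simp only [map_sum, map_smul, smul_eq_mul]
  refine Finset.sum_congr rfl fun d _ => ?_
  rw [mul_comm]
  simp [pd, hu, gradient, chartVec]

/-- The two cross terms agree by symmetry of `g^{ij}`. Writing their sum as a derivative along `grad
f` lets the outer defect act on the inner one. -/
theorem Lbnz_laplaceBeltrami [IsManifold (𝓡 m) ∞ M] {ι : M → EuclideanSpace ℝ (Fin D)}
    (hι : Manifold.IsSmoothEmbedding (𝓡 m) 𝓘(ℝ, EuclideanSpace ℝ (Fin D)) ∞ ι) {p : M}
    {f g : M → ℝ} (hf : ContMDiffAt (𝓡 m) 𝓘(ℝ) ∞ f p) (hg : ContMDiffAt (𝓡 m) 𝓘(ℝ) ∞ g p) :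
    Lbnz (laplaceBeltrami (m := m) ι) f g p =
      2 * fderiv ℝ (inChart p g) (extChartAt (𝓡 m) p p) (chartVec (gradient ι f p)) := by
  have h : ∑ d, pd d (inChart p f) (extChartAt (𝓡 m) p p) *
        gradCoeff ι p g d (extChartAt (𝓡 m) p p) =
      ∑ d, pd d (inChart p g) (extChartAt (𝓡 m) p p) *
        gradCoeff ι p f d (extChartAt (𝓡 m) p p) := by
    simp only [gradCoeff, Finset.mul_sum]
    rw [Finset.sum_comm]
    refine Finset.sum_congr rfl fun i _ => Finset.sum_congr rfl fun j _ => ?_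
    rw [metricInvCoeff_symm ι p _ i j]
    ring
  rw [Lbnz_laplaceBeltrami_eq_sum hι hf hg, Finset.sum_add_distrib, h, sum_pd_mul_gradCoeff]
  ring

/-! ### Differentials and the tangential projection. -/

theorem push_eq_fderiv {F : M → EuclideanSpace ℝ (Fin D)} {p : M}
    (hF : ContMDiffAt (𝓡 m) 𝓘(ℝ, EuclideanSpace ℝ (Fin D)) ∞ F p) (u : TangentSpace (𝓡 m) p) :
    push F p u = fderiv ℝ (inChart p F) (extChartAt (𝓡 m) p p) (chartVec u) :=
  mfderiv_eq_fderiv_inChart (hF.mdifferentiableAt (by simp)) u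

theorem push_zero (F : M → EuclideanSpace ℝ (Fin D)) (p : M) :
    push F p (0 : TangentSpace (𝓡 m) p) = 0 :=
  map_zero _

/-- The projection is self-adjoint and idempotent. -/
theorem inner_tangentProj_eq (m : ℕ) {M : Type*} [TopologicalSpace M]
    [ChartedSpace (EuclideanSpace ℝ (Fin m)) M] (ι : M → EuclideanSpace ℝ (Fin D))
    (a b : EuclideanSpace ℝ (Fin D)) (p : M) :
    inner ℝ (tangentProj m ι a p) b = inner ℝ (tangentProj m ι a p) (tangentProj m ι b p) := by
  rw [tangentProj, tangentProj, ← Submodule.inner_starProjection_left_eq_right,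
    Submodule.starProjection_eq_self_iff.mpr (Submodule.starProjection_apply_mem _ _)]

theorem inner_tangentProj_push (ι : M → EuclideanSpace ℝ (Fin D))
    (a : EuclideanSpace ℝ (Fin D)) (p : M) (u : TangentSpace (𝓡 m) p) :
    inner ℝ (tangentProj m ι a p) (push ι p u) = inner ℝ a (push ι p u) := by
  rw [tangentProj, Submodule.inner_starProjection_left_eq_right,
    Submodule.starProjection_eq_self_iff.mpr]
  exact LinearMap.mem_range_self _ u

theorem tangentProj_eq_zero_iff {ι : M → EuclideanSpace ℝ (Fin D)}
    {a : EuclideanSpace ℝ (Fin D)} {p : M} :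
    tangentProj m ι a p = 0 ↔ IsNormalVector (m := m) ι p a := by
  rw [tangentProj, Submodule.starProjection_apply_eq_zero_iff, Submodule.mem_orthogonal']
  constructor
  · intro h u
    exact h _ (LinearMap.mem_range_self _ u)
  · rintro h _ ⟨u, rfl⟩
    exact h u

/-! ### Affine functions of the embedding -/

/-- The restriction `p ↦ ⟨a, p⟩ + c` of an affine function. -/
def affineFun (ι : M → EuclideanSpace ℝ (Fin D)) (a : EuclideanSpace ℝ (Fin D)) (c : ℝ) : M → ℝ :=
  fun p => inner ℝ a (ι p) + c

theorem coordFun_eq_affineFun {M : Type*} (ι : M → EuclideanSpace ℝ (Fin D)) (d : Fin D) :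
    coordFun ι d = affineFun ι (EuclideanSpace.single d 1) 0 := by
  ext p
  simp [coordFun, affineFun, EuclideanSpace.inner_single_left]

theorem height_eq_affineFun {M : Type*} (ι : M → EuclideanSpace ℝ (Fin D)) (q : M)
    (n : EuclideanSpace ℝ (Fin D)) :
    height ι q n = affineFun ι n (-inner ℝ n (ι q)) := by
  ext p
  rw [height, affineFun, inner_sub_right, sub_eq_add_neg]

theorem contMDiff_inner_left {F : M → EuclideanSpace ℝ (Fin D)}
    (hF : ContMDiff (𝓡 m) 𝓘(ℝ, EuclideanSpace ℝ (Fin D)) ∞ F)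
    (a : EuclideanSpace ℝ (Fin D)) :
    ContMDiff (𝓡 m) 𝓘(ℝ) ∞ (fun p => inner ℝ a (F p)) :=
  (innerSL ℝ a).contDiff.contMDiff.comp hF

theorem contMDiff_affineFun {ι : M → EuclideanSpace ℝ (Fin D)}
    (hι : ContMDiff (𝓡 m) 𝓘(ℝ, EuclideanSpace ℝ (Fin D)) ∞ ι) (a : EuclideanSpace ℝ (Fin D))
    (c : ℝ) : ContMDiff (𝓡 m) 𝓘(ℝ) ∞ (affineFun ι a c) :=
  (contMDiff_inner_left hι a).add contMDiff_const

theorem fderiv_const_inner {F : EuclideanSpace ℝ (Fin m) → EuclideanSpace ℝ (Fin D)}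
    {x : EuclideanSpace ℝ (Fin m)} (hF : DifferentiableAt ℝ F x) (a : EuclideanSpace ℝ (Fin D))
    (u : EuclideanSpace ℝ (Fin m)) :
    fderiv ℝ (fun y => inner ℝ a (F y)) x u = inner ℝ a (fderiv ℝ F x u) := by
  rw [fderiv_inner_apply ℝ (differentiableAt_const a) hF]
  simp

theorem fderiv_inChart_affineFun {ι : M → EuclideanSpace ℝ (Fin D)} {p : M}
    {x : EuclideanSpace ℝ (Fin m)} (hF : DifferentiableAt ℝ (inChart p ι) x)
    (a : EuclideanSpace ℝ (Fin D)) (c : ℝ) (u : EuclideanSpace ℝ (Fin m)) :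
    fderiv ℝ (inChart p (affineFun ι a c)) x u = inner ℝ a (fderiv ℝ (inChart p ι) x u) := by
  change fderiv ℝ (fun y => inner ℝ a (inChart p ι y) + c) x u = _
  rw [fderiv_add_const, fderiv_const_inner hF]

/-- The components `∑ j, g^{ij}⟨∂_j ι, a⟩` of the gradient are those of the projection in the chart
formula. -/
theorem push_gradient_affineFun [IsManifold (𝓡 m) ∞ M] {ι : M → EuclideanSpace ℝ (Fin D)}
    (hι : Manifold.IsSmoothEmbedding (𝓡 m) 𝓘(ℝ, EuclideanSpace ℝ (Fin D)) ∞ ι)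
    (a : EuclideanSpace ℝ (Fin D)) (c : ℝ) (p : M) :
    push ι p (gradient (m := m) ι (affineFun ι a c) p) = tangentProj m ι a p := by
  have hx := mem_extChartAt_target (I := 𝓡 m) p
  have hF := (contDiffAt_inChart_embedding hι hx).differentiableAt (by simp)
  have h := tangentProj_eq_of_mem_target hι hx a
  rw [extChartAt_to_inv p] at h
  rw [h, push_eq_fderiv hι.contMDiff.contMDiffAt, chartVec, gradient]
  congr 2
  ext d
  simp only [gradCoeff]
  refine Finset.sum_congr rfl fun i _ => ?_
  rw [pd, fderiv_inChart_affineFun hF, real_inner_comm]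
  rfl

/-- An identity of functions on all of `M`, as the outer defect requires; the 2 is absorbed into the
fixed vector so that the result is a constant paired with a smooth map. -/
theorem Lbnz_affineFun [IsManifold (𝓡 m) ∞ M] {ι : M → EuclideanSpace ℝ (Fin D)}
    (hι : Manifold.IsSmoothEmbedding (𝓡 m) 𝓘(ℝ, EuclideanSpace ℝ (Fin D)) ∞ ι)
    (a b : EuclideanSpace ℝ (Fin D)) (c c' : ℝ) :
    Lbnz (laplaceBeltrami (m := m) ι) (affineFun ι a c) (affineFun ι b c') =
      fun p => inner ℝ ((2 : ℝ) • b) (tangentProj m ι a p) := by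
  ext p
  have hx := mem_extChartAt_target (I := 𝓡 m) p
  have hF := (contDiffAt_inChart_embedding hι hx).differentiableAt (by simp)
  rw [Lbnz_laplaceBeltrami hι (contMDiff_affineFun hι.contMDiff a c).contMDiffAt
    (contMDiff_affineFun hι.contMDiff b c').contMDiffAt, fderiv_inChart_affineFun hF,
    real_inner_smul_left, ← push_gradient_affineFun hι a c p,
    push_eq_fderiv hι.contMDiff.contMDiffAt]

theorem nestedLbnz_affineFun [IsManifold (𝓡 m) ∞ M] {ι : M → EuclideanSpace ℝ (Fin D)}
    (hι : Manifold.IsSmoothEmbedding (𝓡 m) 𝓘(ℝ, EuclideanSpace ℝ (Fin D)) ∞ ι) {f : M → ℝ}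
    (hf : ContMDiff (𝓡 m) 𝓘(ℝ) ∞ f) (a b : EuclideanSpace ℝ (Fin D)) (c c' : ℝ) (q : M) :
    nestedLbnz (m := m) ι f (affineFun ι a c) (affineFun ι b c') q =
      4 * inner ℝ (push (m := m) (tangentProj m ι a) q (gradient (m := m) ι f q)) b := by
  have hx := mem_extChartAt_target (I := 𝓡 m) q
  have hP := contMDiff_tangentProj (m := m) hι a
  have hS : DifferentiableAt ℝ (inChart (m := m) q (tangentProj m ι a)) (extChartAt (𝓡 m) q q) :=
    (contDiffAt_inChart hx hP.contMDiffAt).differentiableAt (by simp)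
  rw [nestedLbnz, Lbnz_affineFun hι, Lbnz_laplaceBeltrami hι hf.contMDiffAt
    (contMDiff_inner_left hP _).contMDiffAt, push_eq_fderiv hP.contMDiffAt]
  change 2 * fderiv ℝ (fun y => inner ℝ ((2 : ℝ) • b) (inChart (m := m) q (tangentProj m ι a) y))
    _ _ = _
  rw [fderiv_const_inner hS, real_inner_smul_left, real_inner_comm]
  ring

/-! ### Normal sections and the second fundamental form -/

theorem isNormalSectionOn_sub_tangentProj [IsManifold (𝓡 m) ∞ M]
    {ι : M → EuclideanSpace ℝ (Fin D)}
    (hι : Manifold.IsSmoothEmbedding (𝓡 m) 𝓘(ℝ, EuclideanSpace ℝ (Fin D)) ∞ ι)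
    (n : EuclideanSpace ℝ (Fin D)) :
    IsNormalSectionOn (m := m) ι Set.univ (fun p => n - tangentProj m ι n p) where
  smooth := (contMDiff_const.sub (contMDiff_tangentProj hι n)).contMDiffOn
  normal p _ u := by
    rw [inner_sub_left, inner_tangentProj_push, sub_self]

/-- Differentiate `⟨N, dι v⟩ = 0` along `u`. The right side sees only `N q`, so it yields
independence of the section as well as symmetry. -/
theorem shapeOperator_eq_inner_second_deriv [IsManifold (𝓡 m) ∞ M]
    {ι : M → EuclideanSpace ℝ (Fin D)}
    (hι : Manifold.IsSmoothEmbedding (𝓡 m) 𝓘(ℝ, EuclideanSpace ℝ (Fin D)) ∞ ι) {U : Set M}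
    (hU : IsOpen U) {q : M} (hq : q ∈ U) {N : M → EuclideanSpace ℝ (Fin D)}
    (hN : IsNormalSectionOn (m := m) ι U N) (u v : TangentSpace (𝓡 m) q) :
    shapeOperator (m := m) ι N q u v =
      inner ℝ (N q) (fderiv ℝ (fderiv ℝ (inChart q ι)) (extChartAt (𝓡 m) q q)
        (chartVec u) (chartVec v)) := by
  have hx := mem_extChartAt_target (I := 𝓡 m) q
  set x := extChartAt (𝓡 m) q q
  have hxq : (extChartAt (𝓡 m) q).symm x = q := extChartAt_to_inv q
  have hNq := hN.smooth.contMDiffAt (hU.mem_nhds hq)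
  have hNd : DifferentiableAt ℝ (inChart q N) x :=
    (contDiffAt_inChart hx (by rwa [hxq])).differentiableAt (by simp)
  have hF := contDiffAt_inChart_embedding hι hx
  have hF' : DifferentiableAt ℝ (fderiv ℝ (inChart q ι)) x :=
    (hF.fderiv_right (m := ∞) (by simp)).differentiableAt (by simp)
  have hv : DifferentiableAt ℝ (fun y => fderiv ℝ (inChart q ι) y (chartVec v)) x :=
    hF'.clm_apply (differentiableAt_const _)
  have hzero : (fun y => inner ℝ (inChart q N y) (fderiv ℝ (inChart q ι) y (chartVec v))) =ᶠ[𝓝 x]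
      fun _ => (0 : ℝ) := by
    have hc : ContinuousAt (extChartAt (𝓡 m) q).symm x := continuousAt_extChartAt_symm q
    filter_upwards [extChartAt_target_mem_nhds_of_mem hx,
      hc.preimage_mem_nhds (hU.mem_nhds (by rwa [hxq]))] with y hy hyU
    obtain ⟨A, hA⟩ := fderiv_inChart_eq_comp (f := ι) hy
      (hι.contMDiff.contMDiffAt.mdifferentiableAt (by simp))
    rw [hA]
    exact hN.normal _ hyU _
  have h := fderiv_inner_apply ℝ hNd hv (chartVec u)
  rw [hzero.fderiv_eq, fderiv_clm_apply hF' (differentiableAt_const _)] at h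
  rw [shapeOperator, push_eq_fderiv hNq, push_eq_fderiv hι.contMDiff.contMDiffAt]
  have hNx : inChart q N x = N q := by rw [inChart, hxq]
  simp [hNx] at h
  linarith

theorem shapeOperator_comm [IsManifold (𝓡 m) ∞ M] {ι : M → EuclideanSpace ℝ (Fin D)}
    (hι : Manifold.IsSmoothEmbedding (𝓡 m) 𝓘(ℝ, EuclideanSpace ℝ (Fin D)) ∞ ι) {U : Set M}
    (hU : IsOpen U) {q : M} (hq : q ∈ U) {N : M → EuclideanSpace ℝ (Fin D)}
    (hN : IsNormalSectionOn (m := m) ι U N) (u v : TangentSpace (𝓡 m) q) :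
    shapeOperator (m := m) ι N q u v = shapeOperator (m := m) ι N q v u := by
  rw [shapeOperator_eq_inner_second_deriv hι hU hq hN,
    shapeOperator_eq_inner_second_deriv hι hU hq hN]
  congr 1
  have h := (contDiffAt_inChart_embedding hι (mem_extChartAt_target (I := 𝓡 m) q))
  exact (h.isSymmSndFDerivAt (by
    rw [minSmoothness_of_isRCLikeNormedField]
    exact WithTop.coe_le_coe.2 (le_top (a := (2 : ℕ∞))))).eq _ _

/-- `⟨P n, w⟩ = ⟨P n, P w⟩`, and both factors vanish at `q`, so the derivative does too. -/
theorem inner_push_tangentProj [IsManifold (𝓡 m) ∞ M] {ι : M → EuclideanSpace ℝ (Fin D)}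
    (hι : Manifold.IsSmoothEmbedding (𝓡 m) 𝓘(ℝ, EuclideanSpace ℝ (Fin D)) ∞ ι) {q : M}
    {n w : EuclideanSpace ℝ (Fin D)} (hn : IsNormalVector (m := m) ι q n)
    (hw : IsNormalVector (m := m) ι q w) (u : TangentSpace (𝓡 m) q) :
    inner ℝ (push (m := m) (tangentProj m ι n) q u) w = 0 := by
  have hx := mem_extChartAt_target (I := 𝓡 m) q
  set x := extChartAt (𝓡 m) q q
  have hxq : (extChartAt (𝓡 m) q).symm x = q := extChartAt_to_inv q
  have hd : ∀ a, DifferentiableAt ℝ (inChart (m := m) q (tangentProj m ι a)) x := fun a =>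
    (contDiffAt_inChart hx (contMDiff_tangentProj hι a).contMDiffAt).differentiableAt (by simp)
  have h0 : ∀ a, IsNormalVector (m := m) ι q a → inChart q (tangentProj m ι a) x = 0 := by
    intro a ha
    rw [inChart, hxq, tangentProj_eq_zero_iff.mpr ha]
  rw [push_eq_fderiv (contMDiff_tangentProj hι n).contMDiffAt, real_inner_comm,
    ← fderiv_const_inner (hd n)]
  have h1 : (fun y => inner ℝ w (inChart (m := m) q (tangentProj m ι n) y)) =
      fun y => inner ℝ (inChart (m := m) q (tangentProj m ι n) y)
        (inChart (m := m) q (tangentProj m ι w) y) := by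
    ext y
    rw [real_inner_comm]
    exact inner_tangentProj_eq m ι n w _
  rw [h1, fderiv_inner_apply ℝ (hd n) (hd w), h0 n hn, h0 w hw]
  simp

theorem shapeOperator_gradient [IsManifold (𝓡 m) ∞ M] {ι : M → EuclideanSpace ℝ (Fin D)}
    (hι : Manifold.IsSmoothEmbedding (𝓡 m) 𝓘(ℝ, EuclideanSpace ℝ (Fin D)) ∞ ι) {q : M}
    {n : EuclideanSpace ℝ (Fin D)} (hn : IsNormalVector (m := m) ι q n) {U : Set M}
    (hU : IsOpen U) (hq : q ∈ U) {N : M → EuclideanSpace ℝ (Fin D)}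
    (hN : IsNormalSectionOn (m := m) ι U N) (hNq : N q = n) (u : TangentSpace (𝓡 m) q)
    (b : EuclideanSpace ℝ (Fin D)) (c : ℝ) :
    shapeOperator (m := m) ι N q u (gradient (m := m) ι (affineFun ι b c) q) =
      inner ℝ (push (m := m) (tangentProj m ι n) q u) b := by
  have h0 := isNormalSectionOn_sub_tangentProj hι n
  have hS := (contMDiff_tangentProj (m := m) hι n).contMDiffAt (x := q)
  have hn0 : n - tangentProj m ι n q = N q := by
    rw [tangentProj_eq_zero_iff.mpr hn, sub_zero, hNq]
  have hpush : push (fun p => n - tangentProj m ι n p) q u =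
      -push (m := m) (tangentProj m ι n) q u := by
    rw [push_eq_fderiv (contMDiffAt_const.sub hS), push_eq_fderiv hS]
    change fderiv ℝ (fun y => n - inChart q (tangentProj m ι n) y) _ _ = _
    rw [fderiv_const_sub]
    rfl
  -- Pass from `N` to the section `n - P n`, which has the same value at `q`.
  rw [shapeOperator_eq_inner_second_deriv hι hU hq hN, ← hn0,
    ← shapeOperator_eq_inner_second_deriv hι isOpen_univ (Set.mem_univ q) h0, shapeOperator,
    hpush, inner_neg_left, neg_neg, push_gradient_affineFun hι]
  -- The derivative of `P n` is orthogonal to the normal part of `b`, so `P b` may be replaced by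
  -- `b`.
  have hw : IsNormalVector (m := m) ι q (b - tangentProj m ι b q) :=
    (isNormalSectionOn_sub_tangentProj hι b).normal q (Set.mem_univ q)
  have := inner_push_tangentProj hι hn hw u
  rw [inner_sub_right] at this
  linarith

/-- The first two terms each contribute `4 s` by symmetry and the third is zero, which accounts for
the factor `1/8`. -/
theorem shapeExpr_eq_shapeOperator [IsManifold (𝓡 m) ∞ M] {ι : M → EuclideanSpace ℝ (Fin D)}
    (hι : Manifold.IsSmoothEmbedding (𝓡 m) 𝓘(ℝ, EuclideanSpace ℝ (Fin D)) ∞ ι) {q : M}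
    {n : EuclideanSpace ℝ (Fin D)} (hn : IsNormalVector (m := m) ι q n) {U : Set M}
    (hU : IsOpen U) (hq : q ∈ U) {N : M → EuclideanSpace ℝ (Fin D)}
    (hN : IsNormalSectionOn (m := m) ι U N) (hNq : N q = n) (d₁ d₂ : Fin D) :
    shapeExpr m ι q n d₁ d₂ = shapeOperator (m := m) ι N q (gradient (m := m) ι (coordFun ι d₁) q)
      (gradient (m := m) ι (coordFun ι d₂) q) := by
  have hgrad : gradient (m := m) ι (height ι q n) q = 0 := by
    apply mfderiv_injective_of_isSmoothEmbedding hι q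
    rw [map_zero, height_eq_affineFun]
    exact (push_gradient_affineFun hι n _ q).trans (tangentProj_eq_zero_iff.mpr hn)
  have h3 : nestedLbnz (m := m) ι (height ι q n) (coordFun ι d₁) (coordFun ι d₂) q = 0 := by
    have hη : ContMDiff (𝓡 m) 𝓘(ℝ) ∞ (height ι q n) := by
      rw [height_eq_affineFun]
      exact contMDiff_affineFun hι.contMDiff _ _
    rw [coordFun_eq_affineFun, coordFun_eq_affineFun, nestedLbnz_affineFun hι hη, hgrad, push_zero,
      inner_zero_left, mul_zero]
  have h : ∀ d d' : Fin D,
      nestedLbnz (m := m) ι (coordFun ι d) (height ι q n) (coordFun ι d') q =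
        4 * shapeOperator (m := m) ι N q (gradient (m := m) ι (coordFun ι d) q)
          (gradient (m := m) ι (coordFun ι d') q) := by
    intro d d'
    have hφ : ContMDiff (𝓡 m) 𝓘(ℝ) ∞ (coordFun ι d) := by
      rw [coordFun_eq_affineFun]
      exact contMDiff_affineFun hι.contMDiff _ _
    rw [height_eq_affineFun, coordFun_eq_affineFun ι d', nestedLbnz_affineFun hι hφ,
      shapeOperator_gradient hι hn hU hq hN hNq]
  rw [shapeExpr, h3, h, h, shapeOperator_comm hι hU hq hN (gradient (m := m) ι (coordFun ι d₂) q)]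
  ring

/-! ### Curves with prescribed velocity -/

theorem metricNorm_eq_norm_push (ι : M → EuclideanSpace ℝ (Fin D)) (p : M)
    (u : TangentSpace (𝓡 m) p) : metricNorm ι p u = ‖push ι p u‖ := by
  rw [metricNorm, metric, norm_eq_sqrt_real_inner]

/-- Supplies the competitors for the maximization. -/
theorem exists_derivesTangent {ι : M → EuclideanSpace ℝ (Fin D)}
    (hι : ContMDiff (𝓡 m) 𝓘(ℝ, EuclideanSpace ℝ (Fin D)) ∞ ι) (q : M)
    (v : TangentSpace (𝓡 m) q) : ∃ γ : ℝ → M, DerivesTangent ι q γ v := by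
  have hx := mem_extChartAt_target (I := 𝓡 m) q
  set x := extChartAt (𝓡 m) q q
  obtain ⟨r, hr, hball⟩ := Metric.isOpen_iff.mp (isOpen_extChartAt_target q) x hx
  set w := chartVec v with hw
  set ε : ℝ := r / (‖w‖ + 1) with hε
  have hε0 : 0 < ε := by positivity
  -- The curve must exist for all times: `ε sin(s/ε)` has slope 1 at 0 but is bounded by `ε`, and
  -- `ε‖w‖ < r` keeps `c` in the chart ball; the `+ 1` in `ε` covers `w = 0`.
  set c : ℝ → EuclideanSpace ℝ (Fin m) := fun s => x + (ε * Real.sin (s / ε)) • w with hc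
  have hc0 : c 0 = x := by simp [hc]
  have hcm : ∀ s, c s ∈ (extChartAt (𝓡 m) q).target := by
    intro s
    apply hball
    rw [mem_ball_iff_norm, hc, add_sub_cancel_left, norm_smul, Real.norm_eq_abs, abs_mul,
      abs_of_pos hε0]
    calc ε * |Real.sin (s / ε)| * ‖w‖ ≤ ε * 1 * ‖w‖ := by
          gcongr
          exact Real.abs_sin_le_one _
      _ < ε * (‖w‖ + 1) := by linarith
      _ = r := by rw [hε]; field_simp
  have hcd : HasDerivAt c w 0 := by
    have h1 : HasDerivAt (fun s : ℝ => ε * Real.sin (s / ε)) 1 0 := by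
      have h2 := (((hasDerivAt_id (0 : ℝ)).div_const ε).sin).const_mul ε
      convert! h2 using 1
      simp [hε0.ne']
    have h3 := (h1.smul_const w).const_add x
    rwa [one_smul] at h3
  refine ⟨fun s => (extChartAt (𝓡 m) q).symm (c s), ?_, ?_, ?_⟩
  · exact (continuousOn_extChartAt_symm q).comp_continuous (by fun_prop) hcm
  · simp only [hc0]
    exact extChartAt_to_inv q
  · have hF : HasFDerivAt (inChart q ι) (fderiv ℝ (inChart q ι) (c 0)) (c 0) := by
      rw [hc0]
      refine (MDifferentiableAt.differentiableWithinAt_writtenInExtChartAt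
        (hι.contMDiffAt.mdifferentiableAt (by simp))).differentiableAt ?_ |>.hasFDerivAt
      simp
    have h := hF.comp_hasDerivAt 0 hcd
    rw [hc0, ← push_eq_fderiv hι.contMDiffAt] at h
    exact h

theorem DerivesTangent.deriv_coordFun {ι : M → EuclideanSpace ℝ (Fin D)} {q : M} {γ : ℝ → M}
    {v : TangentSpace (𝓡 m) q} (h : DerivesTangent ι q γ v) (d : Fin D) :
    deriv (fun s => coordFun ι d (γ s)) 0 =
      inner ℝ (tangentProj m ι (EuclideanSpace.single d 1) q) (push ι q v) := by
  rw [inner_tangentProj_push]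
  have h1 := (EuclideanSpace.proj (𝕜 := ℝ) d).hasFDerivAt.comp_hasDerivAt (0 : ℝ) h.velocity
  have h2 : HasDerivAt (fun s => coordFun ι d (γ s)) (push ι q v d) 0 := h1
  rw [h2.deriv]
  simp [EuclideanSpace.inner_single_left]

theorem push_smul (ι : M → EuclideanSpace ℝ (Fin D)) (p : M) (r : ℝ)
    (u : TangentSpace (𝓡 m) p) : push ι p (r • u) = r • push ι p u :=
  map_smul (mfderiv (𝓡 m) 𝓘(ℝ, EuclideanSpace ℝ (Fin D)) ι p) r u

/-- A vector derived by a coordinate curve of speed `c` is the multiple of length `c` of the gradient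
of the coordinate, written without division. -/
theorem IsCoordDerived.norm_gradient_smul_eq [IsManifold (𝓡 m) ∞ M]
    {ι : M → EuclideanSpace ℝ (Fin D)}
    (hι : Manifold.IsSmoothEmbedding (𝓡 m) 𝓘(ℝ, EuclideanSpace ℝ (Fin D)) ∞ ι) {q : M}
    {d : Fin D} {c : ℝ} {v : TangentSpace (𝓡 m) q} (h : IsCoordDerived ι q d c v) :
    metricNorm ι q (gradient (m := m) ι (coordFun ι d) q) • v =
      c • gradient (m := m) ι (coordFun ι d) q := by
  obtain ⟨γ, hγ, hc, hmax⟩ := h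
  set g := gradient (m := m) ι (coordFun ι d) q with hg
  have hG : push ι q g = tangentProj m ι (EuclideanSpace.single d 1) q := by
    rw [hg, coordFun_eq_affineFun, push_gradient_affineFun hι]
  have hder : ∀ (γ' : ℝ → M) (v' : TangentSpace (𝓡 m) q), DerivesTangent ι q γ' v' →
      deriv (fun s => coordFun ι d (γ' s)) 0 = inner ℝ (push ι q g) (push ι q v') := by
    intro γ' v' h'
    rw [h'.deriv_coordFun, hG]
  rw [metricNorm_eq_norm_push] at hc ⊢
  apply mfderiv_injective_of_isSmoothEmbedding hι q
  change push ι q _ = push ι q _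
  rw [push_smul, push_smul]
  by_cases h0 : push ι q g = 0
  · simp [h0]
  have hn0 : ‖push ι q g‖ ≠ 0 := norm_ne_zero_iff.mpr h0
  have hc0 : 0 ≤ c := hc ▸ norm_nonneg _
  -- Comparison with the gradient direction at speed `c` gives `c‖grad‖ ≤ ⟨grad, v⟩`, the equality
  -- case of Cauchy–Schwarz.
  obtain ⟨γ', hγ'⟩ := exists_derivesTangent hι.contMDiff q ((c / ‖push ι q g‖) • g)
  have h1 := hmax γ' _ hγ' (by
    rw [metricNorm_eq_norm_push, push_smul, norm_smul, norm_div, norm_norm, Real.norm_eq_abs,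
      abs_of_nonneg hc0, div_mul_cancel₀ _ hn0])
  rw [hder _ _ hγ', hder _ _ hγ, push_smul, real_inner_smul_right, real_inner_self_eq_norm_sq] at h1
  have h2 := real_inner_le_norm (push ι q g) (push ι q v)
  have h3 : inner ℝ (push ι q g) (push ι q v) = ‖push ι q g‖ * ‖push ι q v‖ := by
    refine le_antisymm h2 (le_trans (le_of_eq ?_) h1)
    rw [hc]
    field_simp
  rw [← hc]
  exact (inner_eq_norm_mul_iff_real.mp h3).symm

theorem IsCoordDerived.eq_gradient [IsManifold (𝓡 m) ∞ M]
    {ι : M → EuclideanSpace ℝ (Fin D)}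
    (hι : Manifold.IsSmoothEmbedding (𝓡 m) 𝓘(ℝ, EuclideanSpace ℝ (Fin D)) ∞ ι) {q : M}
    {d : Fin D} {v : TangentSpace (𝓡 m) q}
    (h : IsCoordDerived ι q d (metricNorm ι q (gradient (m := m) ι (coordFun ι d) q)) v) :
    v = gradient (m := m) ι (coordFun ι d) q := by
  -- If the gradient vanishes, nothing can be cancelled, but then `v` has speed zero as well.
  by_cases h0 : metricNorm ι q (gradient (m := m) ι (coordFun ι d) q) = 0
  · obtain ⟨γ, -, hc, -⟩ := h
    rw [h0, metricNorm_eq_norm_push, norm_eq_zero] at hc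
    rw [metricNorm_eq_norm_push, norm_eq_zero] at h0
    exact mfderiv_injective_of_isSmoothEmbedding hι q (hc.trans h0.symm)
  · exact smul_right_injective _ h0 (h.norm_gradient_smul_eq hι)

theorem shapeOperator_smul_smul (ι N : M → EuclideanSpace ℝ (Fin D)) (p : M) (a b : ℝ)
    (u v : TangentSpace (𝓡 m) p) :
    shapeOperator ι N p (a • u) (b • v) = a * b * shapeOperator ι N p u v := by
  rw [shapeOperator, push_smul, push_smul, real_inner_smul_left, real_inner_smul_right,
    shapeOperator]
  ring

end CurveShape

end

/-! ### The proposition, for gradient speeds and for arbitrary speeds. -/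

theorem mainTheorem3 {m D : ℕ} {M : Type*} [TopologicalSpace M]
    [ChartedSpace (EuclideanSpace ℝ (Fin m)) M] [IsManifold (𝓡 m) ∞ M]
    (ι : M → EuclideanSpace ℝ (Fin D))
    (hι : Manifold.IsSmoothEmbedding (𝓡 m) 𝓘(ℝ, EuclideanSpace ℝ (Fin D)) ∞ ι)
    (q : M) (n : EuclideanSpace ℝ (Fin D)) (hn : CurveShape.IsNormalVector (m := m) ι q n)
    (d₁ d₂ : Fin D) (c₁ c₂ : ℝ) (v₁ v₂ : TangentSpace (𝓡 m) q)
    (hv₁ : CurveShape.IsCoordDerived ι q d₁ c₁ v₁)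
    (hv₂ : CurveShape.IsCoordDerived ι q d₂ c₂ v₂) :
    (∃ N : M → EuclideanSpace ℝ (Fin D),
      CurveShape.IsNormalSectionOn (m := m) ι Set.univ N ∧ N q = n) ∧
    ∀ (U : Set M) (N : M → EuclideanSpace ℝ (Fin D)), IsOpen U → q ∈ U →
      CurveShape.IsNormalSectionOn (m := m) ι U N → N q = n →
        (c₁ = CurveShape.metricNorm ι q
              (CurveShape.gradient (m := m) ι (CurveShape.coordFun ι d₁) q) →
          c₂ = CurveShape.metricNorm ι q
              (CurveShape.gradient (m := m) ι (CurveShape.coordFun ι d₂) q) →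
          CurveShape.shapeOperator ι N q v₁ v₂ = CurveShape.shapeExpr m ι q n d₁ d₂) ∧
        CurveShape.metricNorm ι q
              (CurveShape.gradient (m := m) ι (CurveShape.coordFun ι d₁) q) *
            CurveShape.metricNorm ι q
              (CurveShape.gradient (m := m) ι (CurveShape.coordFun ι d₂) q) *
            CurveShape.shapeOperator ι N q v₁ v₂
          = c₁ * c₂ * CurveShape.shapeExpr m ι q n d₁ d₂ := by
  refine ⟨⟨fun p => n - CurveShape.tangentProj m ι n p,
    CurveShape.isNormalSectionOn_sub_tangentProj hι n, ?_⟩, ?_⟩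
  · simp [CurveShape.tangentProj_eq_zero_iff.mpr hn]
  intro U N hU hq hN hNq
  rw [CurveShape.shapeExpr_eq_shapeOperator hι hn hU hq hN hNq]
  constructor
  · rintro rfl rfl
    rw [hv₁.eq_gradient hι, hv₂.eq_gradient hι]
  -- The scalar factors move into the arguments on both sides, so no division by a possibly zero
  -- gradient occurs.
  · rw [← CurveShape.shapeOperator_smul_smul, ← CurveShape.shapeOperator_smul_smul,
      hv₁.norm_gradient_smul_eq hι, hv₂.norm_gradient_smul_eq hι]
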